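/- **Model.** Time is divided into cycles, each consisting of a transmission step (fully processed packets leave the queue), an arrival step (new packets arrive; the policy chooses which of the buffered and newly arrived packets to keep, at most $B$ in total, $B\ge 2$) and a processing step (at most one buffered packet receives one unit of processing). The queue is initially empty. Each packet $p$ has a work $w(p)\in\{w,w+1,\dots,W\}$ (the number of processing cycles it requires) and a profit $v(p)\in\{1,\dots,V\}$, all integers. These two characteristics are either known upon arrival or unknown upon arrival; those of an unknown packet are revealed when the packet is first processed. At most $M$ unknown packets arrive in any one cycle. The throughput on a finite input sequence (after whose end the queue keeps operating without arrivals) is the total profit of all packets that are eventually transmitted. The decisions of a deterministic online algorithm in a cycle depend only on what it has observed so far: the arrivals up to and including that cycle, with the characteristics of the known packets, and the characteristics of the packets it has processed in earlier cycles. A randomized online algorithm is a random choice of a deterministic online algorithm. It is $c$-competitive if, on every finite input sequence, the throughput of every policy (possibly clairvoyant) is at most $c$ times the expected throughput of the algorithm; its competitive ratio is the infimum of all such $c$ ($\infty$ if there is none). **Theorem.** Let $B\ge 2$, $V\ge 1$, $M\ge 1$, $W\ge 2$ and $1\le w\le W$ be integers with $(V,w)\ne(1,W)$. Then every randomized online algorithm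 has competitive ratio at least $$\frac{V(W-1)}{w}\left[1-\left(1-\frac{1}{V(W-1)+1-w}\right)^{Mw}\right].$$ -/

import Mathlib

open MeasureTheory
open scoped ENNReal NNReal

namespace PacketQueue

/-- The parameters of the system: buffer size `B`, maximal number `M` of unknown packets arriving
in one cycle, profits in `{1, …, V}`, works in `{w, …, W}`. -/
structure Params where
  B : ℕ
  M : ℕ
  V : ℕ
  w : ℕ
  W : ℕ

/-- A unit-size packet: its required number of processing cycles, its profit, and whether these
two characteristics are known on arrival (a `K`-packet) or not (a `U`-packet). -/
structure Packet where
  work : ℕ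
  profit : ℕ
  known : Bool

/-- What an online algorithm sees of a packet on its arrival. -/
def Packet.visible (p : Packet) : Option (ℕ × ℕ) :=
  if p.known then some (p.work, p.profit) else none

/-- A finite input sequence: entry `t` lists the packets arriving in cycle `t`. No packet arrives
after the end of the list, but the queue goes on operating. -/
abbrev Input := List (List Packet)

/-- A packet is named by its cycle of arrival and its position among the arrivals of that cycle. -/
abbrev PacketId := ℕ × ℕ

namespace Input

/-- The packets arriving in cycle `t`. -/
def arrivals (σ : Input) (t : ℕ) : List Packet := σ.getD t []

/-- The names of the packets arriving in cycle `t`. -/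
def arrivalIds (σ : Input) (t : ℕ) : Finset PacketId :=
  (Finset.range (arrivals σ t).length).image fun i => (t, i)

/-- The packet with a given name, if there is one. -/
def packet? (σ : Input) (q : PacketId) : Option Packet := (arrivals σ q.1)[q.2]?

def workOf (σ : Input) (q : PacketId) : ℕ := (packet? σ q).elim 0 Packet.work

def profitOf (σ : Input) (q : PacketId) : ℕ := (packet? σ q).elim 0 Packet.profit

/-- The input sequences of the model: works in `{w, …, W}`, profits in `{1, …, V}`, and at most `M`
unknown packets per cycle. -/
structure Admissible (P : Params) (σ : Input) : Prop where
  work_mem : ∀ l ∈ σ, ∀ p ∈ l, P.w ≤ p.work ∧ p.work ≤ P.W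
  profit_mem : ∀ l ∈ σ, ∀ p ∈ l, 1 ≤ p.profit ∧ p.profit ≤ P.V
  unknown_le : ∀ l ∈ σ, l.countP (fun p => !p.known) ≤ P.M

end Input

/-- The decisions of a queue management policy on an input sequence: the content of the buffer
after the arrival step of each cycle (what has been neither dropped nor pushed out), and the packet,
if any, processed in the processing step of that cycle. -/
structure Schedule where
  buffer : ℕ → Finset PacketId
  processed : ℕ → Option PacketId

namespace Schedule

/-- The number of processing cycles that packet `q` has received before cycle `t`. -/
def service (S : Schedule) (q : PacketId) (t : ℕ) : ℕ :=
  ((Finset.range t).filter fun s => S.processed s = some q).card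

/-- The packets leaving the queue in the transmission step of cycle `t`: the buffered packets that
are fully processed. The queue is empty initially. -/
def transmitted (S : Schedule) (σ : Input) : ℕ → Finset PacketId
  | 0 => ∅
  | t + 1 => (S.buffer t).filter fun q => Input.workOf σ q ≤ S.service q (t + 1)

/-- The content of the buffer between the transmission step and the arrival step of cycle `t`. -/
def carried (S : Schedule) (σ : Input) : ℕ → Finset PacketId
  | 0 => ∅
  | t + 1 => S.buffer t \ S.transmitted σ (t + 1)

/-- The schedule can be carried out on the input `σ` with a buffer of size `B`. -/
structure Feasible (B : ℕ) (σ : Input) (S : Schedule) : Prop where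
  buffer_subset : ∀ t, S.buffer t ⊆ S.carried σ t ∪ Input.arrivalIds σ t
  buffer_card : ∀ t, (S.buffer t).card ≤ B
  processed_mem : ∀ t q, S.processed t = some q → q ∈ S.buffer t

/-- The overall profit of all packets transmitted out of the queue. -/
noncomputable def throughput (S : Schedule) (σ : Input) : ℝ≥0∞ :=
  ∑' t, ∑ q ∈ S.transmitted σ t, (Input.profitOf σ q : ℝ≥0∞)

end Schedule

/-- When making its decisions of cycle `t`, a policy following the schedule `S` on `σ` cannot tell
`σ` from `σ'`: the arrivals up to cycle `t` look the same, and so do the characteristics of all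
packets processed in earlier cycles (processing an unknown packet once reveals them). -/
def Indistinguishable (S : Schedule) (σ σ' : Input) (t : ℕ) : Prop :=
  (∀ s ≤ t, (Input.arrivals σ s).map Packet.visible = (Input.arrivals σ' s).map Packet.visible) ∧
  ∀ s < t, ∀ q, S.processed s = some q → Input.packet? σ q = Input.packet? σ' q

/-- A deterministic online algorithm: a feasible schedule for every input sequence, such that the
decisions in every cycle depend only on what the algorithm has observed by then. It need not be
greedy or work-conserving. -/
structure OnlineAlgorithm (P : Params) where
  schedule : Input → Schedule
  feasible : ∀ σ, Input.Admissible P σ → (schedule σ).Feasible P.B σ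
  nonanticipating : ∀ σ σ', Input.Admissible P σ → Input.Admissible P σ' → ∀ t,
    Indistinguishable (schedule σ) σ σ' t →
      (schedule σ).buffer t = (schedule σ').buffer t ∧
      (schedule σ).processed t = (schedule σ').processed t

/-- A randomized online algorithm with random seed in `Ω`: a random deterministic online algorithm,
whose throughput on each input sequence is a random variable. -/
structure RandomizedAlgorithm (P : Params) (Ω : Type*) [MeasurableSpace Ω] where
  alg : Ω → OnlineAlgorithm P
  measurable_throughput : ∀ σ, Input.Admissible P σ →
    Measurable fun ω => ((alg ω).schedule σ).throughput σ

namespace RandomizedAlgorithm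

variable {P : Params} {Ω : Type*} [MeasurableSpace Ω]

/-- The expected throughput, when the seed has law `μ`. -/
noncomputable def expectedThroughput (A : RandomizedAlgorithm P Ω) (μ : Measure Ω) (σ : Input) :
    ℝ≥0∞ :=
  ∫⁻ ω, ((A.alg ω).schedule σ).throughput σ ∂μ

/-- `c`-competitiveness: on every finite input sequence the throughput of any (possibly
clairvoyant) policy is at most `c` times the expected throughput of the algorithm. -/
def IsCompetitive (A : RandomizedAlgorithm P Ω) (μ : Measure Ω) (c : ℝ≥0) : Prop :=
  ∀ σ, Input.Admissible P σ → ∀ S : Schedule, S.Feasible P.B σ →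
    S.throughput σ ≤ c * A.expectedThroughput μ σ

/-- The competitive ratio: the infimum of all `c` for which the algorithm is `c`-competitive
(`⊤` if there is none). -/
noncomputable def competitiveRatio (A : RandomizedAlgorithm P Ω) (μ : Measure Ω) : EReal :=
  ⨅ (c : ℝ≥0) (_ : A.IsCompetitive μ c), ((c : ℝ) : EReal)

end RandomizedAlgorithm

end PacketQueue

open MeasureTheory
open scoped ENNReal NNReal

namespace PacketQueue

/-! The proof is Yao's principle: a random input is exhibited on which every deterministic online
algorithm does badly on average. In each of `T` cycles `M` unknown packets arrive, each
independently good (work `w`, profit `V`) with probability `p = 1 / N`, where `N = V (W - 1) + 1 -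
w`, and otherwise bad (work `W`, profit `1`).

The value of `p` makes an online algorithm indifferent. Price a cycle at `1 / (W - 1)`. A bad packet
whose type is revealed needs `W - 1` more cycles for profit `1`, so it is worth nothing beyond their
price; a revealed good one is worth `V - (w - 1) / (W - 1) = N / (W - 1)`. Hence a first cycle also
yields `1 / (W - 1)` on average, and no strategy earns more than that per cycle in expectation
(`OnlineAlgorithm.expected_totalPotential_le`). Packets still buffered when the input ends add at
most `B V`.

A clairvoyant policy splits time into blocks of `w` cycles and serves, in each block, a good packet
of the preceding block if there is one. A block has `M w` arrivals, so the expected profit per block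
is `V (1 - (1 - p) ^ (M w))` (`le_expected_throughput_blockSchedule`), against `w / (W - 1)` online.
As the number of blocks grows, the additive `B V` becomes negligible and the quotient of the two
rates remains. -/

/-! ### Random subsets -/

/-- The probability of `G` when each element of `U` is selected independently with
probability `p`. -/
noncomputable def subsetWeight {α : Type*} (p : ℝ) (U G : Finset α) : ℝ :=
  p ^ G.card * (1 - p) ^ (U.card - G.card)

section subsetWeight

variable {α : Type*} {p : ℝ}

lemma subsetWeight_nonneg (h0 : 0 ≤ p) (h1 : p ≤ 1) (U G : Finset α) :
    0 ≤ subsetWeight p U G :=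
  mul_nonneg (pow_nonneg h0 _) (pow_nonneg (sub_nonneg.2 h1) _)

lemma sum_subsetWeight (p : ℝ) (U : Finset α) :
    ∑ G ∈ U.powerset, subsetWeight p U G = 1 := by
  simp [subsetWeight, Finset.sum_pow_mul_eq_add_pow]

variable [DecidableEq α]

/-- These `G` are the subsets of `U \ C`, and the weight relative to `U` is `(1 - p) ^ C.card` times
the weight relative to `U \ C`. -/
lemma sum_subsetWeight_disjoint (p : ℝ) {U C : Finset α} (hC : C ⊆ U) :
    ∑ G ∈ U.powerset with Disjoint G C, subsetWeight p U G = (1 - p) ^ C.card := by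
  have hset : U.powerset.filter (fun G => Disjoint G C) = (U \ C).powerset := by
    ext G
    simp [Finset.subset_sdiff]
  rw [hset]
  refine Eq.trans ?_ ((congrArg ((1 - p) ^ C.card * ·) (sum_subsetWeight p (U \ C))).trans
    (mul_one _))
  rw [Finset.mul_sum]
  refine Finset.sum_congr rfl fun G hG => ?_
  have h1 := Finset.card_le_card (Finset.mem_powerset.1 hG)
  have h2 := Finset.card_sdiff_add_card_eq_card hC
  have h3 : U.card - G.card = C.card + ((U \ C).card - G.card) := by omega
  rw [subsetWeight, subsetWeight, h3, pow_add]
  ring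

lemma sum_subsetWeight_not_disjoint (p : ℝ) {U C : Finset α} (hC : C ⊆ U) :
    ∑ G ∈ U.powerset with ¬ Disjoint G C, subsetWeight p U G = 1 - (1 - p) ^ C.card := by
  rw [← sum_subsetWeight_disjoint p hC, ← sum_subsetWeight p U,
    ← Finset.sum_filter_add_sum_filter_not U.powerset (fun G => Disjoint G C)]
  ring

/-- Change the membership of `x` in `G`. -/
def toggle (x : α) (G : Finset α) : Finset α := if x ∈ G then G.erase x else insert x G

lemma toggle_toggle (x : α) (G : Finset α) : toggle x (toggle x G) = G := by
  by_cases h : x ∈ G <;> simp [toggle, h]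

lemma toggle_ne (x : α) (G : Finset α) : toggle x G ≠ G := by
  by_cases h : x ∈ G <;> simp [toggle, h]

lemma toggle_subset {x : α} {U G : Finset α} (hx : x ∈ U) (hG : G ⊆ U) : toggle x G ⊆ U := by
  unfold toggle
  split_ifs
  · exact (Finset.erase_subset _ _).trans hG
  · exact Finset.insert_subset hx hG

lemma mem_toggle_of_ne {x y : α} (G : Finset α) (h : y ≠ x) : y ∈ toggle x G ↔ y ∈ G := by
  by_cases hx : x ∈ G <;> simp [toggle, hx, h]

/-- The odds of membership are `p : 1 - p`; the cross-multiplied form also covers `p = 1`. -/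
lemma subsetWeight_insert {U G : Finset α} {x : α} (hx : x ∈ U) (hG : G ⊆ U) (hxG : x ∉ G) :
    subsetWeight p U (insert x G) * (1 - p) = subsetWeight p U G * p := by
  have h : (insert x G).card ≤ U.card := Finset.card_le_card (Finset.insert_subset hx hG)
  rw [Finset.card_insert_of_notMem hxG] at h
  have h3 : U.card - G.card = (U.card - (G.card + 1)) + 1 := by omega
  rw [subsetWeight, subsetWeight, Finset.card_insert_of_notMem hxG, h3]
  ring

/-- A fair bet on the membership of `x` has the same expected gain on `G` and `toggle x G`. -/
lemma subsetWeight_toggle {U G : Finset α} {x : α} (hp : p ≠ 0) (hx : x ∈ U) (hG : G ⊆ U) :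
    subsetWeight p U G * ((if x ∈ G then 1 / p else 0) - 1) +
      subsetWeight p U (toggle x G) * ((if x ∈ toggle x G then 1 / p else 0) - 1) = 0 := by
  by_cases h : x ∈ G
  · have h1 := subsetWeight_insert (p := p) hx ((Finset.erase_subset x G).trans hG)
      (Finset.notMem_erase x G)
    rw [Finset.insert_erase h] at h1
    simp only [toggle, h, if_true, Finset.notMem_erase, if_false]
    field_simp
    linarith
  · have h1 := subsetWeight_insert (p := p) hx hG h
    simp only [toggle, h, if_false, Finset.mem_insert_self, if_true]
    field_simp
    linarith

/-- The expected gain of a fair bet on an element chosen independently of its membership. -/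
lemma sum_subsetWeight_bet {U : Finset α} (hp : p ≠ 0) (c : Finset α → Option α)
    (hU : ∀ G ⊆ U, ∀ x, c G = some x → x ∈ U)
    (hc : ∀ G ⊆ U, ∀ x, c G = some x → c (toggle x G) = some x) :
    ∑ G ∈ U.powerset, subsetWeight p U G *
      (c G).elim 0 (fun x => (if x ∈ G then 1 / p else 0) - 1) = 0 := by
  -- Pair `G` with `toggle x G`, where `x` is the element bet on. By `hc` the bet is the same on
  -- both, so this is an involution and each pair cancels. Sets without a bet are fixed and
  -- contribute zero.
  refine Finset.sum_involution (fun G _ => (c G).elim G fun x => toggle x G) ?_ ?_ ?_ ?_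
  · intro G hG
    rw [Finset.mem_powerset] at hG
    cases h : c G with
    | none => simp [h]
    | some x =>
      simp only [Option.elim_some, hc G hG x h]
      exact subsetWeight_toggle hp (hU G hG x h) hG
  · intro G hG hne
    cases h : c G with
    | none => simp [h] at hne
    | some x => exact toggle_ne x G
  · intro G hG
    rw [Finset.mem_powerset] at hG ⊢
    cases h : c G with
    | none => exact hG
    | some x => exact toggle_subset (hU G hG x h) hG
  · intro G hG
    rw [Finset.mem_powerset] at hG
    cases h : c G with
    | none => simp [h]
    | some x => simp only [Option.elim_some, hc G hG x h, toggle_toggle]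

end subsetWeight

/-! ### Feasible schedules -/

lemma Input.mem_arrivalIds {σ : Input} {t : ℕ} {q : PacketId} :
    q ∈ arrivalIds σ t ↔ q.1 = t ∧ q.2 < (arrivals σ t).length := by
  obtain ⟨a, b⟩ := q
  simp only [arrivalIds, Finset.mem_image, Finset.mem_range, Prod.mk.injEq]
  constructor
  · rintro ⟨i, hi, rfl, rfl⟩
    exact ⟨rfl, hi⟩
  · rintro ⟨rfl, h⟩
    exact ⟨b, h, rfl, rfl⟩

namespace Schedule

variable {S : Schedule} {σ : Input} {B : ℕ}

lemma service_mono (S : Schedule) (q : PacketId) : Monotone (S.service q) := fun _ _ h =>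
  Finset.card_le_card (Finset.filter_subset_filter _ (Finset.range_mono h))

lemma service_succ (S : Schedule) (q : PacketId) (t : ℕ) :
    S.service q (t + 1) = S.service q t + if S.processed t = some q then 1 else 0 := by
  simp only [service, Finset.range_add_one, Finset.filter_insert]
  split_ifs <;> simp

lemma service_eq_zero {q : PacketId} {t : ℕ} (h : S.service q t = 0) {s : ℕ} (hs : s < t) :
    S.processed s ≠ some q := by
  rw [service, Finset.card_eq_zero, Finset.filter_eq_empty_iff] at h
  exact h (Finset.mem_range.2 hs)

lemma transmitted_succ_subset (S : Schedule) (σ : Input) (t : ℕ) :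
    S.transmitted σ (t + 1) ⊆ S.buffer t := Finset.filter_subset _ _

lemma carried_succ_subset (S : Schedule) (σ : Input) (t : ℕ) :
    S.carried σ (t + 1) ⊆ S.buffer t := Finset.sdiff_subset

namespace Feasible

lemma arrived (h : S.Feasible B σ) {t : ℕ} {q : PacketId} (hq : q ∈ S.buffer t) :
    q.1 ≤ t ∧ q.2 < (Input.arrivals σ q.1).length := by
  induction t with
  | zero =>
    rcases Finset.mem_union.1 (h.buffer_subset 0 hq) with h1 | h1
    · simp [carried] at h1
    · obtain ⟨h1, h2⟩ := Input.mem_arrivalIds.1 h1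
      exact ⟨h1.le, h1 ▸ h2⟩
  | succ t ih =>
    rcases Finset.mem_union.1 (h.buffer_subset (t + 1) hq) with h1 | h1
    · obtain ⟨h2, h3⟩ := ih (carried_succ_subset S σ t h1)
      exact ⟨by omega, h3⟩
    · obtain ⟨h1, h2⟩ := Input.mem_arrivalIds.1 h1
      exact ⟨h1.le, h1 ▸ h2⟩

/-- A packet can enter the buffer only in its arrival cycle, so one that has left never returns.
Hence no profit is counted twice in the throughput. -/
lemma notMem_buffer_of_transmitted (h : S.Feasible B σ) {t s : ℕ} {q : PacketId}
    (hq : q ∈ S.transmitted σ t) (hs : t ≤ s) : q ∉ S.buffer s := by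
  cases t with
  | zero => simp [transmitted] at hq
  | succ t =>
    have hle := (h.arrived (transmitted_succ_subset S σ t hq)).1
    induction s, hs using Nat.le_induction with
    | base =>
      intro hb
      rcases Finset.mem_union.1 (h.buffer_subset _ hb) with h1 | h1
      · exact (Finset.mem_sdiff.1 h1).2 hq
      · have := (Input.mem_arrivalIds.1 h1).1
        omega
    | succ s hs ih =>
      intro hb
      rcases Finset.mem_union.1 (h.buffer_subset _ hb) with h1 | h1
      · exact ih (carried_succ_subset S σ s h1)
      · have := (Input.mem_arrivalIds.1 h1).1
        omega

lemma disjoint_transmitted (h : S.Feasible B σ) {s t : ℕ} (hst : s < t) :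
    Disjoint (S.transmitted σ s) (S.transmitted σ t) := by
  obtain ⟨t, rfl⟩ : ∃ u, t = u + 1 := ⟨t - 1, by omega⟩
  rw [Finset.disjoint_left]
  intro q hs ht
  exact h.notMem_buffer_of_transmitted hs (Nat.lt_succ_iff.1 hst)
    (transmitted_succ_subset S σ t ht)

lemma buffer_antitone (h : S.Feasible B σ) {s t : ℕ} (hs : σ.length ≤ s) (hst : s ≤ t) :
    S.buffer t ⊆ S.buffer s := by
  induction t, hst using Nat.le_induction with
  | base => rfl
  | succ t hst ih =>
    intro q hq
    rcases Finset.mem_union.1 (h.buffer_subset _ hq) with h1 | h1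
    · exact ih (carried_succ_subset S σ t h1)
    · have h2 := (Input.mem_arrivalIds.1 h1).2
      rw [Input.arrivals, List.getD_eq_default _ _ (by omega)] at h2
      simp at h2

/-- Every packet that is ever transmitted is finished when the input ends, or is then buffered. -/
lemma throughput_le (h : S.Feasible B σ) (U : Finset PacketId)
    (hU : ∀ t, S.buffer t ⊆ U) :
    S.throughput σ ≤ ∑ q ∈ U with Input.workOf σ q ≤ S.service q σ.length,
      (Input.profitOf σ q : ℝ≥0∞) +
      ∑ q ∈ S.buffer σ.length, (Input.profitOf σ q : ℝ≥0∞) := by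
  classical
  refine ENNReal.tsum_le_of_sum_range_le fun n => ?_
  rw [← Finset.sum_biUnion]
  · refine le_trans (Finset.sum_le_sum_of_subset (t := U.filter (fun q =>
      Input.workOf σ q ≤ S.service q σ.length) ∪ S.buffer σ.length) ?_) ?_
    · intro q hq
      obtain ⟨t, -, hq⟩ := Finset.mem_biUnion.1 hq
      cases t with
      | zero => simp [transmitted] at hq
      | succ t =>
        obtain ⟨hb, hw⟩ := Finset.mem_filter.1 hq
        rcases le_or_gt (t + 1) σ.length with hle | hlt
        · exact Finset.mem_union_left _ (Finset.mem_filter.2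
            ⟨hU t hb, hw.trans (service_mono S q hle)⟩)
        · exact Finset.mem_union_right _ (h.buffer_antitone le_rfl (by omega) hb)
    · rw [← Finset.sum_union_inter]
      exact le_self_add
  · intro s _ t _ hst
    rcases lt_or_gt_of_ne hst with h1 | h1
    · exact h.disjoint_transmitted h1
    · exact (h.disjoint_transmitted h1).symm

end Feasible

end Schedule

/-! ### The random input -/

section hardInput

variable {P : Params} {T : ℕ}

/-- An unknown packet: cheap and valuable, or expensive and of profit one. -/
def unknownPacket (P : Params) (good : Prop) [Decidable good] : Packet :=
  if good then ⟨P.w, P.V, false⟩ else ⟨P.W, 1, false⟩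

/-- In each of `T` cycles `M` unknown packets arrive; `G` is the set of the good ones. -/
def hardInput (P : Params) (T : ℕ) (G : Finset PacketId) : Input :=
  (List.range T).map fun t => (List.range P.M).map fun i => unknownPacket P ((t, i) ∈ G)

/-- The names of all packets of `hardInput`. -/
def hardIds (P : Params) (T : ℕ) : Finset PacketId := Finset.range T ×ˢ Finset.range P.M

lemma mem_hardIds {q : PacketId} : q ∈ hardIds P T ↔ q.1 < T ∧ q.2 < P.M := by
  simp [hardIds]

lemma length_hardInput (G : Finset PacketId) : (hardInput P T G).length = T := by
  simp [hardInput]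

lemma arrivals_hardInput (G : Finset PacketId) (t : ℕ) :
    Input.arrivals (hardInput P T G) t =
      if t < T then (List.range P.M).map fun i => unknownPacket P ((t, i) ∈ G) else [] := by
  rw [Input.arrivals, hardInput, List.getD_eq_getElem?_getD, List.getElem?_map]
  split_ifs with h
  · rw [List.getElem?_range h]
    rfl
  · rw [List.getElem?_eq_none (by simpa using h)]
    rfl

lemma packet?_hardInput (G : Finset PacketId) {q : PacketId} (hq : q ∈ hardIds P T) :
    Input.packet? (hardInput P T G) q = some (unknownPacket P (q ∈ G)) := by
  rw [mem_hardIds] at hq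
  rw [Input.packet?, arrivals_hardInput, if_pos hq.1, List.getElem?_map, List.getElem?_range hq.2]
  rfl

lemma workOf_hardInput (G : Finset PacketId) {q : PacketId} (hq : q ∈ hardIds P T) :
    Input.workOf (hardInput P T G) q = if q ∈ G then P.w else P.W := by
  rw [Input.workOf, packet?_hardInput G hq, Option.elim_some, unknownPacket]
  split_ifs <;> rfl

lemma profitOf_hardInput (G : Finset PacketId) {q : PacketId} (hq : q ∈ hardIds P T) :
    Input.profitOf (hardInput P T G) q = if q ∈ G then P.V else 1 := by
  rw [Input.profitOf, packet?_hardInput G hq, Option.elim_some, unknownPacket]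
  split_ifs <;> rfl

lemma mem_arrivalIds_hardInput (G : Finset PacketId) {q : PacketId} (hq : q ∈ hardIds P T) :
    q ∈ Input.arrivalIds (hardInput P T G) q.1 := by
  rw [mem_hardIds] at hq
  rw [Input.mem_arrivalIds, arrivals_hardInput, if_pos hq.1]
  simpa using hq.2

lemma Schedule.Feasible.buffer_subset_hardIds {S : Schedule} {B : ℕ} {G : Finset PacketId}
    (h : S.Feasible B (hardInput P T G)) (t : ℕ) : S.buffer t ⊆ hardIds P T := by
  intro q hq
  have h1 := (h.arrived hq).2
  rw [arrivals_hardInput] at h1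
  split_ifs at h1 with h2
  · exact mem_hardIds.2 ⟨h2, by simpa using h1⟩
  · simp at h1

lemma admissible_hardInput (hV : 1 ≤ P.V) (hwW : P.w ≤ P.W) (G : Finset PacketId) :
    Input.Admissible P (hardInput P T G) := by
  have key : ∀ l ∈ hardInput P T G, ∀ p ∈ l,
      (P.w ≤ p.work ∧ p.work ≤ P.W) ∧ (1 ≤ p.profit ∧ p.profit ≤ P.V) := by
    intro l hl p hp
    obtain ⟨t, -, rfl⟩ := List.mem_map.1 hl
    obtain ⟨i, -, rfl⟩ := List.mem_map.1 hp
    rw [unknownPacket]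
    split_ifs <;> simp [hV, hwW]
  refine ⟨fun l hl p hp => (key l hl p hp).1, fun l hl p hp => (key l hl p hp).2, ?_⟩
  intro l hl
  obtain ⟨t, -, rfl⟩ := List.mem_map.1 hl
  exact List.countP_le_length.trans (by simp)

lemma map_visible_hardInput (G G' : Finset PacketId) (t : ℕ) :
    (Input.arrivals (hardInput P T G) t).map Packet.visible =
      (Input.arrivals (hardInput P T G') t).map Packet.visible := by
  have : ∀ (g : Prop) [Decidable g], (unknownPacket P g).visible = none := by
    intro g _
    rw [unknownPacket]
    split_ifs <;> rfl
  rw [arrivals_hardInput, arrivals_hardInput]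
  split_ifs <;> simp [this, Function.comp_def]

/-- Until it processes `x`, an online algorithm does not notice whether `x` is good. -/
lemma OnlineAlgorithm.processed_toggle (A : OnlineAlgorithm P) (hV : 1 ≤ P.V) (hwW : P.w ≤ P.W)
    (G : Finset PacketId) {x : PacketId} {t s : ℕ}
    (hx : (A.schedule (hardInput P T G)).service x t = 0) (hs : s ≤ t) :
    (A.schedule (hardInput P T (toggle x G))).processed s =
      (A.schedule (hardInput P T G)).processed s := by
  -- The two inputs differ only in `x`, and all packets look alike on arrival. Cycle `t` itself is
  -- included because its decision precedes whatever processing in that cycle reveals.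
  refine (A.nonanticipating _ _ (admissible_hardInput hV hwW G) (admissible_hardInput hV hwW _) s
    ⟨fun u _ => map_visible_hardInput _ _ u, fun u hu q hq => ?_⟩).2.symm
  have hfeas := A.feasible _ (admissible_hardInput (T := T) hV hwW G)
  have hqU := hfeas.buffer_subset_hardIds u (hfeas.processed_mem u q hq)
  have hne : q ≠ x := by
    rintro rfl
    exact Schedule.service_eq_zero hx (hu.trans_le hs) hq
  rw [packet?_hardInput _ hqU, packet?_hardInput _ hqU]
  simp only [mem_toggle_of_ne G hne]

end hardInput

/-! ### Upper bound for online algorithms -/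

section potential

variable {P : Params} {T : ℕ}

/-- The value of a packet that has received `s` cycles, when a cycle is worth `1 / (W - 1)`. -/
noncomputable def packetPotential (P : Params) (good : Prop) [Decidable good] (s : ℕ) : ℝ :=
  if s = 0 then 0 else
    if good then P.V - ((P.w : ℝ) - s) / ((P.W : ℝ) - 1) else ((s : ℝ) - 1) / ((P.W : ℝ) - 1)

/-- For a good packet, after one cycle the price of the remaining work is at most `(w - 1) / (W - 1)
≤ 1 ≤ V`. Nonnegativity lets unfinished and dropped packets stay in the total when it bounds the
throughput. -/
lemma packetPotential_nonneg (hV : 1 ≤ P.V) (hW : 2 ≤ P.W) (hwW : P.w ≤ P.W)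
    (good : Prop) [Decidable good] (s : ℕ) : 0 ≤ packetPotential P good s := by
  have hV' : (1 : ℝ) ≤ P.V := by exact_mod_cast hV
  have hW' : (2 : ℝ) ≤ P.W := by exact_mod_cast hW
  have hw' : (P.w : ℝ) ≤ P.W := by exact_mod_cast hwW
  rw [packetPotential]
  split_ifs with h0 h1
  · exact le_rfl
  · have hs : (1 : ℝ) ≤ s := by exact_mod_cast Nat.one_le_iff_ne_zero.2 h0
    have : ((P.w : ℝ) - s) / ((P.W : ℝ) - 1) ≤ 1 := by
      rw [div_le_one (by linarith)]
      linarith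
    linarith
  · have hs : (1 : ℝ) ≤ s := by exact_mod_cast Nat.one_le_iff_ne_zero.2 h0
    exact div_nonneg (by linarith) (by linarith)

lemma profit_le_packetPotential (hw : 1 ≤ P.w) (hW : 2 ≤ P.W)
    (good : Prop) [Decidable good] {s : ℕ} (hs : (if good then P.w else P.W) ≤ s) :
    ((if good then P.V else 1 : ℕ) : ℝ) ≤ packetPotential P good s := by
  have hW' : (2 : ℝ) ≤ P.W := by exact_mod_cast hW
  have h0 : s ≠ 0 := by split_ifs at hs <;> omega
  rw [packetPotential, if_neg h0]
  by_cases h1 : good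
  · simp only [h1, if_true] at hs ⊢
    have hs' : (P.w : ℝ) ≤ s := by exact_mod_cast hs
    have : ((P.w : ℝ) - s) / ((P.W : ℝ) - 1) ≤ 0 :=
      div_nonpos_of_nonpos_of_nonneg (by linarith) (by linarith)
    linarith
  · simp only [h1, if_false] at hs ⊢
    have hs' : (P.W : ℝ) ≤ s := by exact_mod_cast hs
    rw [Nat.cast_one, le_div_iff₀ (by linarith)]
    linarith

/-- Once its type is revealed, a packet's potential is affine in the service received, with the same
slope for both types. -/
lemma packetPotential_succ (hW : 2 ≤ P.W) (good : Prop) [Decidable good] {s : ℕ} (hs : s ≠ 0) :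
    packetPotential P good (s + 1) - packetPotential P good s = 1 / ((P.W : ℝ) - 1) := by
  have hW' : (2 : ℝ) ≤ P.W := by exact_mod_cast hW
  have : (P.W : ℝ) - 1 ≠ 0 := by linarith
  simp only [packetPotential, hs, if_false, Nat.add_eq_zero_iff, false_and]
  push_cast
  split_ifs <;> field_simp <;> ring

/-- The jump of a good packet is `N` times the price of a cycle, so at odds `p = 1 / N` the first
cycle is a fair bet. -/
lemma packetPotential_one (hW : 2 ≤ P.W) (good : Prop) [Decidable good] :
    packetPotential P good 1 - packetPotential P good 0 = 1 / ((P.W : ℝ) - 1) *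
      if good then (P.V : ℝ) * ((P.W : ℝ) - 1) + 1 - P.w else 0 := by
  have hW' : (2 : ℝ) ≤ P.W := by exact_mod_cast hW
  have : (P.W : ℝ) - 1 ≠ 0 := by linarith
  simp only [packetPotential, one_ne_zero, if_false, if_true]
  push_cast
  split_ifs
  · field_simp
    ring
  · simp

/-- The total potential at the beginning of cycle `t`; dropped packets keep theirs. -/
noncomputable def totalPotential (P : Params) (T : ℕ) (S : Schedule) (G : Finset PacketId)
    (t : ℕ) : ℝ :=
  ∑ q ∈ hardIds P T, packetPotential P (q ∈ G) (S.service q t)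

/-- The packet that receives its first cycle at time `t`, if there is one. -/
def freshlyProcessed (S : Schedule) (t : ℕ) : Option PacketId :=
  (S.processed t).filter fun q => S.service q t = 0

lemma freshlyProcessed_eq_some {S : Schedule} {t : ℕ} {q : PacketId} :
    freshlyProcessed S t = some q ↔ S.processed t = some q ∧ S.service q t = 0 := by
  simp [freshlyProcessed, Option.filter_eq_some_iff]

/-- Only the processed packet changes potential. The last term is the net gain of the bet made by a
first cycle; the inequality is strict only for an idle cycle. -/
lemma totalPotential_succ_le (hW : 2 ≤ P.W) {S : Schedule} {B : ℕ} {G : Finset PacketId}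
    (h : S.Feasible B (hardInput P T G)) (t : ℕ) :
    totalPotential P T S G (t + 1) ≤ totalPotential P T S G t + 1 / ((P.W : ℝ) - 1) +
      1 / ((P.W : ℝ) - 1) * (freshlyProcessed S t).elim 0
        (fun x => (if x ∈ G then (P.V : ℝ) * ((P.W : ℝ) - 1) + 1 - P.w else 0) - 1) := by
  have hW' : (2 : ℝ) ≤ P.W := by exact_mod_cast hW
  have ha : 0 ≤ 1 / ((P.W : ℝ) - 1) := one_div_nonneg.2 (by linarith)
  cases hp : S.processed t with
  | none =>
    have : totalPotential P T S G (t + 1) = totalPotential P T S G t := by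
      simp [totalPotential, Schedule.service_succ, hp]
    rw [this, freshlyProcessed, hp]
    simpa using ha
  | some x =>
    have hx : x ∈ hardIds P T := h.buffer_subset_hardIds t (h.processed_mem t x hp)
    have hdiff : totalPotential P T S G (t + 1) - totalPotential P T S G t =
        packetPotential P (x ∈ G) (S.service x t + 1) -
          packetPotential P (x ∈ G) (S.service x t) := by
      rw [totalPotential, totalPotential, ← Finset.sum_sub_distrib, Finset.sum_eq_single_of_mem x hx]
      · simp [Schedule.service_succ, hp]
      · intro q _ hq
        simp [Schedule.service_succ, hp, hq.symm]
    by_cases h0 : S.service x t = 0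
    · rw [h0, zero_add, packetPotential_one hW] at hdiff
      rw [freshlyProcessed_eq_some.2 ⟨hp, h0⟩, Option.elim_some]
      linarith
    · rw [packetPotential_succ hW _ h0] at hdiff
      have : freshlyProcessed S t = none := by
        simp [freshlyProcessed, hp, Option.filter_some, h0]
      rw [this, Option.elim_none]
      linarith

/-- This is where being online matters: the choice of a fresh packet is independent of its type, as
`sum_subsetWeight_bet` requires. -/
lemma OnlineAlgorithm.freshlyProcessed_toggle (A : OnlineAlgorithm P) (hV : 1 ≤ P.V)
    (hwW : P.w ≤ P.W) {G : Finset PacketId} {x : PacketId} {t : ℕ}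
    (hx : freshlyProcessed (A.schedule (hardInput P T G)) t = some x) :
    freshlyProcessed (A.schedule (hardInput P T (toggle x G))) t = some x := by
  rw [freshlyProcessed_eq_some] at hx ⊢
  have key := fun s => A.processed_toggle (T := T) hV hwW G hx.2 (s := s)
  refine ⟨(key t le_rfl).trans hx.1, ?_⟩
  rw [← hx.2, Schedule.service, Schedule.service]
  congr 1
  refine Finset.filter_congr fun s hs => ?_
  rw [key s (Finset.mem_range.1 hs).le]

/-- Each cycle increases the expected potential by at most `1 / (W - 1)`. -/
lemma OnlineAlgorithm.expected_totalPotential_le (A : OnlineAlgorithm P) (hV : 1 ≤ P.V)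
    (hW : 2 ≤ P.W) (hwW : P.w ≤ P.W) {p : ℝ} (hp0 : 0 < p) (hp1 : p ≤ 1)
    (hp : 1 / p = (P.V : ℝ) * ((P.W : ℝ) - 1) + 1 - P.w) (t : ℕ) :
    ∑ G ∈ (hardIds P T).powerset, subsetWeight p (hardIds P T) G *
      totalPotential P T (A.schedule (hardInput P T G)) G t ≤ t / ((P.W : ℝ) - 1) := by
  induction t with
  | zero => simp [totalPotential, Schedule.service, packetPotential]
  | succ t ih =>
    have hbet := sum_subsetWeight_bet (U := hardIds P T) hp0.ne'
      (fun G => freshlyProcessed (A.schedule (hardInput P T G)) t)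
      (fun G _ x hx => by
        have hfeas := A.feasible _ (admissible_hardInput (T := T) hV hwW G)
        exact hfeas.buffer_subset_hardIds t
          (hfeas.processed_mem t x (freshlyProcessed_eq_some.1 hx).1))
      (fun G _ x hx => A.freshlyProcessed_toggle hV hwW hx)
    rw [hp] at hbet
    calc _ ≤ ∑ G ∈ (hardIds P T).powerset, subsetWeight p (hardIds P T) G *
          (totalPotential P T (A.schedule (hardInput P T G)) G t + 1 / ((P.W : ℝ) - 1) +
            1 / ((P.W : ℝ) - 1) *
            (freshlyProcessed (A.schedule (hardInput P T G)) t).elim 0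
            (fun x => (if x ∈ G then (P.V : ℝ) * ((P.W : ℝ) - 1) + 1 - P.w else 0) - 1)) := by
          refine Finset.sum_le_sum fun G _ => mul_le_mul_of_nonneg_left ?_
            (subsetWeight_nonneg hp0.le hp1 _ _)
          exact totalPotential_succ_le hW (A.feasible _ (admissible_hardInput hV hwW G)) t
      _ = ∑ G ∈ (hardIds P T).powerset, subsetWeight p (hardIds P T) G *
            totalPotential P T (A.schedule (hardInput P T G)) G t +
          (∑ G ∈ (hardIds P T).powerset, subsetWeight p (hardIds P T) G) *
            (1 / ((P.W : ℝ) - 1)) +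
          (1 / ((P.W : ℝ) - 1)) * ∑ G ∈ (hardIds P T).powerset,
            subsetWeight p (hardIds P T) G *
            (freshlyProcessed (A.schedule (hardInput P T G)) t).elim 0
            (fun x => (if x ∈ G then (P.V : ℝ) * ((P.W : ℝ) - 1) + 1 - P.w else 0) - 1) := by
          rw [Finset.sum_mul, Finset.mul_sum, ← Finset.sum_add_distrib, ← Finset.sum_add_distrib]
          refine Finset.sum_congr rfl fun G _ => ?_
          ring
      _ ≤ _ := by
          rw [hbet, sum_subsetWeight]
          push_cast
          rw [add_div]
          linarith

/-- Packets finished by the end of the input are paid for by their potential. At most `B` others,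
those then buffered, can still bring in up to `V` each. -/
lemma Schedule.Feasible.throughput_le_totalPotential (hV : 1 ≤ P.V) (hw : 1 ≤ P.w) (hW : 2 ≤ P.W)
    (hwW : P.w ≤ P.W) {S : Schedule} {B : ℕ} {G : Finset PacketId}
    (h : S.Feasible B (hardInput P T G)) :
    S.throughput (hardInput P T G) ≤
      ENNReal.ofReal (totalPotential P T S G T + (B : ℝ) * P.V) := by
  have hprofit : ∀ q ∈ S.buffer T, (Input.profitOf (hardInput P T G) q : ℝ≥0∞) ≤ (P.V : ℝ≥0∞) := by
    intro q hq
    rw [profitOf_hardInput G (h.buffer_subset_hardIds T hq)]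
    split_ifs
    · exact le_rfl
    · exact_mod_cast hV
  have hnn : 0 ≤ totalPotential P T S G T :=
    Finset.sum_nonneg fun q _ => packetPotential_nonneg hV hW hwW _ _
  rw [ENNReal.ofReal_add hnn (by positivity)]
  refine (h.throughput_le _ h.buffer_subset_hardIds).trans ?_
  rw [length_hardInput]
  refine add_le_add ?_ ?_
  · rw [totalPotential, ENNReal.ofReal_sum_of_nonneg
      fun q _ => packetPotential_nonneg hV hW hwW _ _]
    refine le_trans (Finset.sum_le_sum fun q hq => ?_)
      (Finset.sum_le_sum_of_subset (Finset.filter_subset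
        (fun q => Input.workOf (hardInput P T G) q ≤ S.service q T) _))
    obtain ⟨hqU, hq⟩ := Finset.mem_filter.1 hq
    rw [workOf_hardInput G hqU] at hq
    rw [profitOf_hardInput G hqU, ← ENNReal.ofReal_natCast]
    exact ENNReal.ofReal_le_ofReal (profit_le_packetPotential hw hW _ hq)
  · refine (Finset.sum_le_card_nsmul _ _ _ hprofit).trans ?_
    rw [nsmul_eq_mul, ENNReal.ofReal_mul (by positivity), ENNReal.ofReal_natCast,
      ENNReal.ofReal_natCast]
    gcongr
    exact h.buffer_card T

/-- The expected throughput of a deterministic online algorithm on the random input. -/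
lemma OnlineAlgorithm.expected_throughput_le (A : OnlineAlgorithm P) (hV : 1 ≤ P.V)
    (hw : 1 ≤ P.w) (hW : 2 ≤ P.W) (hwW : P.w ≤ P.W) {p : ℝ} (hp0 : 0 < p) (hp1 : p ≤ 1)
    (hp : 1 / p = (P.V : ℝ) * ((P.W : ℝ) - 1) + 1 - P.w) :
    ∑ G ∈ (hardIds P T).powerset, ENNReal.ofReal (subsetWeight p (hardIds P T) G) *
      (A.schedule (hardInput P T G)).throughput (hardInput P T G) ≤
      ENNReal.ofReal (T / ((P.W : ℝ) - 1) + (P.B : ℝ) * P.V) := by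
  have hnn : ∀ G, 0 ≤ totalPotential P T (A.schedule (hardInput P T G)) G T + (P.B : ℝ) * P.V :=
    fun G => add_nonneg (Finset.sum_nonneg fun q _ => packetPotential_nonneg hV hW hwW _ _)
      (by positivity)
  calc _ ≤ ∑ G ∈ (hardIds P T).powerset, ENNReal.ofReal (subsetWeight p (hardIds P T) G *
        (totalPotential P T (A.schedule (hardInput P T G)) G T + (P.B : ℝ) * P.V)) := by
        refine Finset.sum_le_sum fun G _ => ?_
        rw [ENNReal.ofReal_mul (subsetWeight_nonneg hp0.le hp1 _ _)]
        gcongr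
        exact (A.feasible _ (admissible_hardInput hV hwW G)).throughput_le_totalPotential
          hV hw hW hwW
    _ = ENNReal.ofReal (∑ G ∈ (hardIds P T).powerset, subsetWeight p (hardIds P T) G *
        (totalPotential P T (A.schedule (hardInput P T G)) G T + (P.B : ℝ) * P.V)) := by
        rw [ENNReal.ofReal_sum_of_nonneg]
        exact fun G _ => mul_nonneg (subsetWeight_nonneg hp0.le hp1 _ _) (hnn G)
    _ ≤ _ := by
        refine ENNReal.ofReal_le_ofReal ?_
        simp only [mul_add, Finset.sum_add_distrib]
        rw [← Finset.sum_mul, sum_subsetWeight, one_mul]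
        exact add_le_add_left (A.expected_totalPotential_le hV hW hwW hp0 hp1 hp T) _

end potential

/-! ### A clairvoyant policy -/

section clairvoyant

variable {P : Params} {T : ℕ} {G : Finset PacketId}

open Classical in
/-- The packet served in the `k`-th block of `w` cycles: a good one from the preceding block. -/
noncomputable def blockChoice (w : ℕ) (G : Finset PacketId) (k : ℕ) : Option PacketId :=
  if h : ∃ q ∈ G, q.1 / w + 1 = k then some h.choose else none

lemma blockChoice_eq_some {w k : ℕ} {q : PacketId} (h : blockChoice w G k = some q) :
    q ∈ G ∧ q.1 / w + 1 = k := by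
  unfold blockChoice at h
  split_ifs at h with hk
  rw [Option.some.injEq] at h
  exact h ▸ hk.choose_spec

lemma exists_blockChoice {w k : ℕ} {q : PacketId} (hq : q ∈ G) (hk : q.1 / w + 1 = k) :
    ∃ q', blockChoice w G k = some q' := by
  have h : ∃ q ∈ G, q.1 / w + 1 = k := ⟨q, hq, hk⟩
  exact ⟨_, dif_pos h⟩

/-- Serve one packet per block, and keep the packet chosen for the next one. -/
noncomputable def blockSchedule (w : ℕ) (G : Finset PacketId) : Schedule where
  buffer t := (blockChoice w G (t / w)).toFinset ∪
    (blockChoice w G (t / w + 1)).toFinset.filter fun q => q.1 ≤ t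
  processed t := blockChoice w G (t / w)

lemma mem_buffer_blockSchedule {w t : ℕ} {q : PacketId} :
    q ∈ (blockSchedule w G).buffer t ↔ blockChoice w G (t / w) = some q ∨
      blockChoice w G (t / w + 1) = some q ∧ q.1 ≤ t := by
  simp [blockSchedule]

/-- A packet is chosen only for the block after the one in which it arrives, so all its service lies
in that single block and it cannot leave before the block ends. -/
lemma service_blockSchedule_lt {w k t : ℕ} (hw : 1 ≤ w) {q : PacketId}
    (hq : blockChoice w G k = some q) (ht : t < (k + 1) * w) :
    (blockSchedule w G).service q t < w := by
  have hsub : ((Finset.range t).filter fun s => (blockSchedule w G).processed s = some q) ⊆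
      Finset.Ico (k * w) t := by
    intro s hs
    obtain ⟨h1, h2⟩ := Finset.mem_filter.1 hs
    have hk : s / w = k := (blockChoice_eq_some h2).2.symm.trans (blockChoice_eq_some hq).2
    exact Finset.mem_Ico.2 ⟨hk ▸ Nat.div_mul_le_self s w, Finset.mem_range.1 h1⟩
  have h := Finset.card_le_card hsub
  rw [Nat.card_Ico] at h
  rw [add_mul, one_mul] at ht
  exact lt_of_le_of_lt h (by omega)

lemma le_service_blockSchedule {w k : ℕ} {q : PacketId}
    (hq : blockChoice w G k = some q) :
    w ≤ (blockSchedule w G).service q ((k + 1) * w) := by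
  have hsub : Finset.Ico (k * w) ((k + 1) * w) ⊆
      (Finset.range ((k + 1) * w)).filter fun s => (blockSchedule w G).processed s = some q := by
    intro s hs
    obtain ⟨h1, h2⟩ := Finset.mem_Ico.1 hs
    refine Finset.mem_filter.2 ⟨Finset.mem_range.2 h2, ?_⟩
    have : s / w = k := Nat.div_eq_of_lt_le h1 h2
    simpa [blockSchedule, this] using hq
  have h := Finset.card_le_card hsub
  rw [Nat.card_Ico, add_mul, one_mul, Nat.add_sub_cancel_left] at h
  rwa [add_mul, one_mul]

/-- Two buffer places suffice: one for the packet in service, one for the packet reserved for the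
next block. -/
lemma feasible_blockSchedule (hw : 1 ≤ P.w) {B : ℕ} (hB : 2 ≤ B) (hG : G ⊆ hardIds P T) :
    (blockSchedule P.w G).Feasible B (hardInput P T G) where
  buffer_card t := by
    refine (Finset.card_union_le _ _).trans (le_trans (add_le_add ?_
      ((Finset.card_filter_le _ _).trans ?_)) (show 1 + 1 ≤ B from hB))
    all_goals
      rw [Option.card_toFinset]
      cases blockChoice P.w G _ <;> simp
  processed_mem t q hq := mem_buffer_blockSchedule.2 (Or.inl hq)
  buffer_subset t q hq := by
    rw [mem_buffer_blockSchedule] at hq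
    have hqG : q ∈ G := by
      rcases hq with h | h
      exacts [(blockChoice_eq_some h).1, (blockChoice_eq_some h.1).1]
    have hqle : q.1 ≤ t := by
      rcases hq with h | h
      · have h1 := (blockChoice_eq_some h).2
        by_contra hlt
        have := Nat.div_le_div_right (c := P.w) (not_le.1 hlt).le
        omega
      · exact h.2
    rcases hqle.eq_or_lt with heq | hlt
    · exact Finset.mem_union_right _ (heq ▸ mem_arrivalIds_hardInput G (hG hqG))
    · refine Finset.mem_union_left _ ?_
      obtain ⟨t, rfl⟩ : ∃ u, t = u + 1 := ⟨t - 1, by omega⟩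
      have hle : q.1 ≤ t := Nat.lt_succ_iff.1 hlt
      have hd1 := Nat.div_le_div_right (c := P.w) hle
      have hd2 : t / P.w ≤ (t + 1) / P.w := Nat.div_le_div_right (Nat.le_succ t)
      have hstep : (t + 1) / P.w ≤ t / P.w + 1 := by
        rw [← Nat.add_div_right t hw]
        exact Nat.div_le_div_right (by omega)
      -- `k` is the block for which `q` is chosen. Whether or not cycle `t + 1` opens a new block,
      -- `q` was already held in cycle `t`, as served or as reserved; since block `k` is not over,
      -- `q` is unfinished.
      obtain ⟨k, hk, hkt, hbuf⟩ : ∃ k, blockChoice P.w G k = some q ∧ (t + 1) / P.w ≤ k ∧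
          q ∈ (blockSchedule P.w G).buffer t := by
        rcases hq with h | h
        · refine ⟨_, h, le_rfl, mem_buffer_blockSchedule.2 ?_⟩
          rcases hd2.eq_or_lt with he | hl
          · exact Or.inl (he ▸ h)
          · have : (t + 1) / P.w = t / P.w + 1 := by omega
            exact Or.inr ⟨this ▸ h, hle⟩
        · refine ⟨_, h.1, by omega, mem_buffer_blockSchedule.2 ?_⟩
          have h1 := (blockChoice_eq_some h.1).2
          have : (t + 1) / P.w = t / P.w := by omega
          exact Or.inr ⟨this ▸ h.1, hle⟩
      refine Finset.mem_sdiff.2 ⟨hbuf, fun htr => ?_⟩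
      have h1 := (Finset.mem_filter.1 htr).2
      rw [workOf_hardInput G (hG hqG), if_pos hqG] at h1
      refine absurd h1 (not_le.2 (service_blockSchedule_lt hw hk ?_))
      exact (Nat.div_lt_iff_lt_mul hw).1 (Nat.lt_succ_of_le hkt)

/-- The packets with names in `hardIds` that arrive in the `k`-th block of `w` cycles. -/
def blockIds (P : Params) (T k : ℕ) : Finset PacketId :=
  (hardIds P T).filter fun q => q.1 / P.w = k

lemma card_blockIds (hw : 1 ≤ P.w) {n k : ℕ} (hk : k < n) :
    (blockIds P (n * P.w) k).card = P.M * P.w := by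
  have : blockIds P (n * P.w) k = Finset.Ico (k * P.w) ((k + 1) * P.w) ×ˢ Finset.range P.M := by
    ext q
    rw [blockIds, Finset.mem_filter, mem_hardIds, Finset.mem_product, Finset.mem_Ico,
      Finset.mem_range]
    constructor
    · rintro ⟨⟨h1, h2⟩, rfl⟩
      exact ⟨⟨Nat.div_mul_le_self _ _, (Nat.div_lt_iff_lt_mul hw).1 (Nat.lt_succ_self _)⟩, h2⟩
    · rintro ⟨⟨h1, h2⟩, h3⟩
      exact ⟨⟨h2.trans_le (Nat.mul_le_mul_right _ hk), h3⟩, Nat.div_eq_of_lt_le h1 h2⟩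
  rw [this, Finset.card_product, Nat.card_Ico, Finset.card_range, add_mul, one_mul,
    Nat.add_sub_cancel_left, mul_comm]

lemma le_throughput_blockSchedule (hw : 1 ≤ P.w) (hG : G ⊆ hardIds P T) (n : ℕ) :
    (((Finset.range n).filter fun k => ¬ Disjoint G (blockIds P T k)).card : ℝ≥0∞) * P.V ≤
      (blockSchedule P.w G).throughput (hardInput P T G) := by
  -- A packet from block `k` is served in block `k + 1` and leaves at the start of cycle `(k + 2) *
  -- w`. Distinct blocks give distinct terms of the throughput series, including a last one that may
  -- fall after the end of the input.
  have hinj : Function.Injective fun k : ℕ => (k + 2) * P.w := fun a b h => by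
    have := Nat.eq_of_mul_eq_mul_right hw h
    omega
  rw [Schedule.throughput, ← nsmul_eq_mul]
  refine le_trans ?_ (ENNReal.tsum_comp_le_tsum_of_injective hinj _)
  refine le_trans ?_ (ENNReal.sum_le_tsum
    ((Finset.range n).filter fun k => ¬ Disjoint G (blockIds P T k)))
  refine Finset.card_nsmul_le_sum _ _ _ fun k hk => ?_
  obtain ⟨q, hqG, hqk⟩ := Finset.not_disjoint_iff.1 (Finset.mem_filter.1 hk).2
  obtain ⟨x, hx⟩ := exists_blockChoice (k := k + 1) hqG
    (congrArg (· + 1) (Finset.mem_filter.1 hqk).2)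
  have hxG := (blockChoice_eq_some hx).1
  have hmem : x ∈ (blockSchedule P.w G).transmitted (hardInput P T G) ((k + 2) * P.w) := by
    obtain ⟨u, hu⟩ : ∃ u, (k + 2) * P.w = u + 1 :=
      ⟨(k + 2) * P.w - 1, by have := Nat.mul_pos (show 0 < k + 2 by omega) hw; omega⟩
    rw [hu]
    refine Finset.mem_filter.2 ⟨mem_buffer_blockSchedule.2 (Or.inl ?_), ?_⟩
    · have : u / P.w = k + 1 := by
        refine Nat.div_eq_of_lt_le ?_ (hu ▸ Nat.lt_succ_self u)
        rw [show k + 2 = (k + 1) + 1 from rfl, add_mul, one_mul] at hu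
        omega
      rw [this, hx]
    · rw [workOf_hardInput G (hG hxG), if_pos hxG, ← hu]
      exact le_service_blockSchedule hx
  refine le_trans (le_of_eq ?_) (Finset.single_le_sum (fun _ _ => zero_le) hmem)
  rw [profitOf_hardInput G (hG hxG), if_pos hxG]

/-- The expected throughput of the clairvoyant policy on `n` blocks of the random input. -/
lemma le_expected_throughput_blockSchedule (hw : 1 ≤ P.w) {p : ℝ} (hp0 : 0 ≤ p) (hp1 : p ≤ 1)
    (n : ℕ) :
    ENNReal.ofReal (n * (1 - (1 - p) ^ (P.M * P.w)) * P.V) ≤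
      ∑ G ∈ (hardIds P (n * P.w)).powerset,
        ENNReal.ofReal (subsetWeight p (hardIds P (n * P.w)) G) *
        (blockSchedule P.w G).throughput (hardInput P (n * P.w) G) := by
  set U := hardIds P (n * P.w) with hU
  have hcount : (n : ℝ) * (1 - (1 - p) ^ (P.M * P.w)) = ∑ G ∈ U.powerset, subsetWeight p U G *
      ((Finset.range n).filter fun k => ¬ Disjoint G (blockIds P (n * P.w) k)).card := by
    simp only [Finset.card_filter, Nat.cast_sum, Finset.mul_sum, Nat.cast_ite, Nat.cast_one,
      Nat.cast_zero, mul_ite, mul_one, mul_zero]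
    -- Linearity of expectation: sum over blocks the probability that the block contains a good
    -- packet.
    rw [Finset.sum_comm]
    simp only [← Finset.sum_filter]
    rw [Finset.sum_congr rfl fun k hk => (sum_subsetWeight_not_disjoint p
      (C := blockIds P (n * P.w) k) (Finset.filter_subset _ _)).trans
        (congrArg (fun m => 1 - (1 - p) ^ m) (card_blockIds hw (Finset.mem_range.1 hk)))]
    simp [mul_sub]
  rw [hcount, Finset.sum_mul, ENNReal.ofReal_sum_of_nonneg]
  · refine Finset.sum_le_sum fun G hG => ?_
    rw [mul_assoc, ENNReal.ofReal_mul (subsetWeight_nonneg hp0 hp1 _ _),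
      ENNReal.ofReal_mul (Nat.cast_nonneg _), ENNReal.ofReal_natCast, ENNReal.ofReal_natCast]
    gcongr
    exact le_throughput_blockSchedule hw (Finset.mem_powerset.1 hG) n
  · exact fun G _ => mul_nonneg (mul_nonneg (subsetWeight_nonneg hp0 hp1 _ _)
      (Nat.cast_nonneg _)) (Nat.cast_nonneg _)

end clairvoyant

/-! ### The lower bound -/

/-- Yao's argument: average the competitiveness inequality over the random input, exchange this
finite average with the expectation over the seed, and apply the deterministic bound to each seed.
-/
lemma RandomizedAlgorithm.IsCompetitive.blocks_le {P : Params} {Ω : Type*} [MeasurableSpace Ω]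
    {μ : Measure Ω} [IsProbabilityMeasure μ] {A : RandomizedAlgorithm P Ω} {c : ℝ≥0}
    (hc : A.IsCompetitive μ c) (hB : 2 ≤ P.B) (hV : 1 ≤ P.V) (hw : 1 ≤ P.w) (hW : 2 ≤ P.W)
    (hwW : P.w ≤ P.W) {p : ℝ} (hp0 : 0 < p) (hp1 : p ≤ 1)
    (hp : 1 / p = (P.V : ℝ) * ((P.W : ℝ) - 1) + 1 - P.w) (n : ℕ) :
    n * (1 - (1 - p) ^ (P.M * P.w)) * P.V ≤
      c * (n * P.w / ((P.W : ℝ) - 1) + (P.B : ℝ) * P.V) := by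
  have hW' : (2 : ℝ) ≤ P.W := by exact_mod_cast hW
  have hnn : 0 ≤ n * P.w / ((P.W : ℝ) - 1) + (P.B : ℝ) * P.V :=
    add_nonneg (div_nonneg (by positivity) (by linarith)) (by positivity)
  refine (ENNReal.ofReal_le_ofReal_iff (mul_nonneg c.coe_nonneg hnn)).1 ?_
  set U := hardIds P (n * P.w) with hU
  calc _ ≤ _ := le_expected_throughput_blockSchedule hw hp0.le hp1 n
    _ ≤ ∑ G ∈ U.powerset, ENNReal.ofReal (subsetWeight p U G) *
        (c * A.expectedThroughput μ (hardInput P (n * P.w) G)) := by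
        refine Finset.sum_le_sum fun G hG => ?_
        gcongr
        exact hc _ (admissible_hardInput hV hwW G) _
          (feasible_blockSchedule hw hB (Finset.mem_powerset.1 hG))
    _ = c * ∫⁻ ω, ∑ G ∈ U.powerset, ENNReal.ofReal (subsetWeight p U G) *
        ((A.alg ω).schedule (hardInput P (n * P.w) G)).throughput
          (hardInput P (n * P.w) G) ∂μ := by
        rw [lintegral_finsetSum _ fun G _ =>
          (A.measurable_throughput _ (admissible_hardInput hV hwW G)).const_mul _, Finset.mul_sum]
        refine Finset.sum_congr rfl fun G _ => ?_
        rw [lintegral_const_mul _ (A.measurable_throughput _ (admissible_hardInput hV hwW G)),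
          RandomizedAlgorithm.expectedThroughput, mul_left_comm]
    _ ≤ c * ∫⁻ _, ENNReal.ofReal (n * P.w / ((P.W : ℝ) - 1) + (P.B : ℝ) * P.V) ∂μ := by
        gcongr with ω
        have := (A.alg ω).expected_throughput_le (T := n * P.w) hV hw hW hwW hp0 hp1 hp
        rwa [Nat.cast_mul] at this
    _ = _ := by
        rw [lintegral_const, measure_univ, mul_one, ENNReal.ofReal_mul c.coe_nonneg,
          ENNReal.ofReal_coe_nnreal]

/-- If `n * x` exceeds `n * y` by at most a constant for all `n`, then `x ≤ y`. -/
lemma le_of_forall_natCast_mul_le {x y d : ℝ} (h : ∀ n : ℕ, n * x ≤ n * y + d) : x ≤ y := by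
  by_contra! hlt
  obtain ⟨n, hn⟩ := exists_nat_gt (d / (x - y))
  rw [div_lt_iff₀ (sub_pos.2 hlt)] at hn
  linarith [h n]

end PacketQueue

theorem theorem1 (B M V w W : ℕ) (hB : 2 ≤ B) (hM : 1 ≤ M) (hV : 1 ≤ V) (hW : 2 ≤ W)
    (hw : 1 ≤ w) (hwW : w ≤ W) (hVw : ¬ (V = 1 ∧ w = W))
    {Ω : Type*} [MeasurableSpace Ω] (μ : MeasureTheory.Measure Ω)
    [MeasureTheory.IsProbabilityMeasure μ]
    (A : PacketQueue.RandomizedAlgorithm ⟨B, M, V, w, W⟩ Ω) :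
    (((V : ℝ) * ((W : ℝ) - 1) / (w : ℝ) *
        (1 - (1 - 1 / ((V : ℝ) * ((W : ℝ) - 1) + 1 - (w : ℝ))) ^ (M * w)) : ℝ) : EReal) ≤
      A.competitiveRatio μ := by
  refine le_iInf₂ fun c hc => EReal.coe_le_coe_iff.2 ?_
  have hW' : (2 : ℝ) ≤ W := by exact_mod_cast hW
  have hw' : (1 : ℝ) ≤ w := by exact_mod_cast hw
  -- This gives `p = 1 / N ≤ 1`. For `V = 1` one has `N = W - w`, which is why `(V, w) = (1, W)` is
  -- excluded; for `V ≥ 2`, `N ≥ W - 1`.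
  have hN : 1 ≤ (V : ℝ) * ((W : ℝ) - 1) + 1 - w := by
    rcases hV.eq_or_lt with rfl | hV2
    · have : (w : ℝ) + 1 ≤ W := by
        exact_mod_cast Nat.lt_of_le_of_ne hwW fun h => hVw ⟨rfl, h⟩
      push_cast
      linarith
    · have h1 : (2 : ℝ) ≤ V := by exact_mod_cast hV2
      have h2 : (w : ℝ) ≤ W := by exact_mod_cast hwW
      nlinarith
  set N := (V : ℝ) * ((W : ℝ) - 1) + 1 - w with hNdef
  have hN0 : 0 < N := by linarith
  -- Letting the number of blocks grow removes the constant `c * (B * V)` due to the final buffer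
  -- content.
  have key : (1 - (1 - 1 / N) ^ (M * w)) * V ≤ c * (w / ((W : ℝ) - 1)) := by
    refine PacketQueue.le_of_forall_natCast_mul_le (d := c * (B * V)) fun n => ?_
    have := hc.blocks_le hB hV hw hW hwW (one_div_pos.2 hN0) ((div_le_one hN0).2 hN)
      (one_div_one_div N) n
    calc _ = n * (1 - (1 - 1 / N) ^ (M * w)) * V := by ring
      _ ≤ _ := this
      _ = _ := by ring
  calc _ = (1 - (1 - 1 / N) ^ (M * w)) * V * (((W : ℝ) - 1) / w) := by ring
    _ ≤ c * (w / ((W : ℝ) - 1)) * (((W : ℝ) - 1) / w) :=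
      mul_le_mul_of_nonneg_right key (div_nonneg (by linarith) (by linarith))
    _ = c := by
      have : (W : ℝ) - 1 ≠ 0 := by linarith
      field_simp
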